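/- Let $m\ge 1$, let $\mathcal M$ be the set of $m\times m$ row-stochastic matrices, and let $\pi$ be a strictly positive probability (row) vector on $[m]=\{1,\dots,m\}$. Put $\mathcal P_\pi:=\{P\in\mathcal M:\ \pi P=\pi\}$. For probability vectors $q,p$ on $[m]$ let $\mathrm{KL}(q,p):=\sum_j q_j\log(q_j/p_j)$ (with $0\log 0=0$) if $p_j=0$ implies $q_j=0$, and $\mathrm{KL}(q,p):=\infty$ otherwise. For an ergodic (irreducible and aperiodic) $Q\in\mathcal M$ with stationary distribution $\pi_Q$ put $$D_{\mathcal M}^{\inf}(Q,\mathcal P_\pi):=\inf_{P\in\mathcal P_\pi}\ \sum_{i\in[m]}\pi_Q(i)\,\mathrm{KL}(Q(i,\cdot),P(i,\cdot)).$$ For $m\ge 2$ (for $m=1$ the only stochastic matrix lies in $\mathcal P_\pi$ and there is nothing to detect), consider the following sequential test of the null $\mathcal P_\pi$ at level $\alpha\in(0,1)$, run on a path $X_0,X_1,X_2,\dots$ in $[m]$. For $t\ge 1$ and $x,y\in[m]$ let $N_{x,y}(t):=\#\{1\le s\le t:\ X_{s-1}=x,\ X_s=y\}$ and $N_x(t):=\sum_y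 N_{x,y}(t)$; let $\widehat Q_t(x,y):=N_{x,y}(t)/N_x(t)$ if $N_x(t)>0$ and $\widehat Q_t(x,y):=1/m$ otherwise; and let $$L_t:=\inf_{P\in\mathcal P_\pi}\ \sum_{x:\,N_x(t)>0}N_x(t)\,\mathrm{KL}(\widehat Q_t(x,\cdot),P(x,\cdot)),$$ $$\beta_t:=\log(1/\alpha)+(m-1)\sum_{x\in[m]}\log\Big(e\Big(1+\frac{N_x(t)}{m-1}\Big)\Big).$$ The test stops (and rejects) at $\tau_\alpha:=\inf\{t\ge 1:\ L_t\ge\beta_t\}\in\mathbb N\cup\{\infty\}$. Then $\mathcal P_\pi$ is compact, and for every ergodic $Q\in\mathcal M$ whose stationary distribution $\pi_Q$ differs from $\pi$, if $(X_t)_{t\ge 0}$ is a Markov chain with transition matrix $Q$ and an arbitrary initial distribution $\mu$, then $$\limsup_{\alpha\downarrow 0}\ \frac{\mathbb E_Q[\tau_\alpha]}{\log(1/\alpha)}\ \le\ \frac{1}{D_{\mathcal M}^{\inf}(Q,\mathcal P_\pi)}.$$ -/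

import Mathlib

open Filter Topology MeasureTheory
open scoped ENNReal Matrix

noncomputable section

namespace MarkovTest

variable {m : ℕ}

/-- The set `𝓜` of `m × m` row-stochastic matrices. -/
def stochasticMatrices (m : ℕ) : Set (Matrix (Fin m) (Fin m) ℝ) :=
  {P | P ∈ Matrix.rowStochastic ℝ (Fin m)}

/-- `π` is a stationary distribution of `P`: a probability vector with `π P = π`. -/
structure IsStationary (π : Fin m → ℝ) (P : Matrix (Fin m) (Fin m) ℝ) : Prop where
  mem_simplex : π ∈ stdSimplex ℝ (Fin m)
  vecMul_eq : π ᵥ* P = π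

/-- The null class `𝓟_π = {P ∈ 𝓜 : π P = π}`. -/
def nullClass (π : Fin m → ℝ) : Set (Matrix (Fin m) (Fin m) ℝ) :=
  {P | P ∈ stochasticMatrices m ∧ π ᵥ* P = π}

/-- A stochastic matrix is ergodic if it is irreducible and aperiodic (for each state, the only
common divisor of the possible return times is `1`). -/
structure IsErgodic (Q : Matrix (Fin m) (Fin m) ℝ) : Prop where
  stochastic : Q ∈ stochasticMatrices m
  irreducible : Q.IsIrreducible
  aperiodic : ∀ i : Fin m, ∀ d : ℕ, (∀ n : ℕ, 1 ≤ n → 0 < (Q ^ n) i i → d ∣ n) → d = 1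

/-- `X 0, X 1, …` is a Markov chain with initial distribution `μ` and transition matrix `Q`
under the measure `ℙ`. -/
structure IsMarkovChain {Ω : Type*} [MeasurableSpace Ω] (ℙ : Measure Ω) (X : ℕ → Ω → Fin m)
    (μ : Fin m → ℝ) (Q : Matrix (Fin m) (Fin m) ℝ) : Prop where
  measurable : ∀ t, Measurable (X t)
  law : ∀ (n : ℕ) (x : ℕ → Fin m), ℙ {ω | ∀ t ≤ n, X t ω = x t} =
    ENNReal.ofReal (μ (x 0) * ∏ t ∈ Finset.range n, Q (x t) (x (t + 1)))

open Classical in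
/-- Kullback-Leibler divergence `∑ j, q j * log (q j / p j)` of probability vectors, equal to `∞`
unless `q ≪ p`. The sum is nonnegative when `q ≪ p` (see `kl_sum_nonneg`), so that
`ENNReal.ofReal` truncates nothing. -/
def kl (q p : Fin m → ℝ) : ℝ≥0∞ :=
  if ∀ j, p j = 0 → q j = 0 then ENNReal.ofReal (∑ j, q j * Real.log (q j / p j)) else ⊤

lemma kl_sum_nonneg {q p : Fin m → ℝ} (hq : q ∈ stdSimplex ℝ (Fin m))
    (hp : p ∈ stdSimplex ℝ (Fin m)) (h : ∀ j, p j = 0 → q j = 0) :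
    0 ≤ ∑ j, q j * Real.log (q j / p j) := by
  have key : ∀ j, q j - p j ≤ q j * Real.log (q j / p j) := by
    intro j
    rcases (hq.1 j).eq_or_lt with h0 | h0
    · simp [← h0, hp.1 j]
    · have hpj : 0 < p j := lt_of_le_of_ne (hp.1 j) fun e => h0.ne' (h j e.symm)
      have h1 := Real.one_sub_inv_le_log_of_pos (div_pos h0 hpj)
      have h2 := mul_le_mul_of_nonneg_left h1 h0.le
      have h3 : q j * (1 - (q j / p j)⁻¹) = q j - p j := by field_simp
      linarith
  calc (0 : ℝ) = ∑ j, (q j - p j) := by rw [Finset.sum_sub_distrib, hq.2, hp.2, sub_self]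
    _ ≤ _ := Finset.sum_le_sum fun j _ => key j

/-- Stationary-weighted divergence `D_𝓜(Q, P) = ∑ i, πQ i * KL(Q(i,·), P(i,·))`, where `πQ` is the
stationary distribution of `Q`. -/
def stationaryKL (πQ : Fin m → ℝ) (Q P : Matrix (Fin m) (Fin m) ℝ) : ℝ≥0∞ :=
  ∑ i, ENNReal.ofReal (πQ i) * kl (Q i) (P i)

/-- `D_𝓜^inf(Q, H) = inf_{P ∈ H} D_𝓜(Q, P)`, with `πQ` the stationary distribution of `Q`. -/
def stationaryKLInf (πQ : Fin m → ℝ) (Q : Matrix (Fin m) (Fin m) ℝ)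
    (H : Set (Matrix (Fin m) (Fin m) ℝ)) : ℝ≥0∞ :=
  ⨅ P ∈ H, stationaryKL πQ Q P

/-! The sequential test, run on a path `x 0, x 1, …`. -/

/-- `N_{u,v}` after `t` transitions: the number of transitions from `u` to `v`. -/
def transCount (x : ℕ → Fin m) (t : ℕ) (u v : Fin m) : ℕ :=
  ((Finset.range t).filter fun s => x s = u ∧ x (s + 1) = v).card

/-- `N_u` after `t` transitions: the number of transitions out of `u`. -/
def visitCount (x : ℕ → Fin m) (t : ℕ) (u : Fin m) : ℕ :=
  ((Finset.range t).filter fun s => x s = u).card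

/-- The empirical transition matrix after `t` transitions (uniform rows at unvisited states). -/
def empirical (x : ℕ → Fin m) (t : ℕ) : Matrix (Fin m) (Fin m) ℝ :=
  fun u v => if 0 < visitCount x t u then (transCount x t u v : ℝ) / visitCount x t u else 1 / m

/-- `ψ_t = ∑ u, log (e (1 + N_u / (m - 1)))`. -/
def psi (x : ℕ → Fin m) (t : ℕ) : ℝ :=
  ∑ u, Real.log (Real.exp 1 * (1 + (visitCount x t u : ℝ) / ((m : ℝ) - 1)))

/-- The boundary `β_t = log (1/α) + (m - 1) ψ_t`. -/
def boundary (α : ℝ) (x : ℕ → Fin m) (t : ℕ) : ℝ :=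
  Real.log (1 / α) + ((m : ℝ) - 1) * psi x t

/-- The statistic `L_t = inf_{P ∈ H} ∑_{u : N_u > 0} N_u KL(Q̂_t(u,·), P(u,·))`. -/
def statistic (H : Set (Matrix (Fin m) (Fin m) ℝ)) (x : ℕ → Fin m) (t : ℕ) : ℝ≥0∞ :=
  ⨅ P ∈ H, ∑ u with 0 < visitCount x t u, (visitCount x t u : ℝ≥0∞) * kl (empirical x t u) (P u)

/-- The stopping time `τ_α`: the first `t ≥ 1` with `L_t ≥ β_t`, and `∞` if there is none,
for the null class `H`.
For `α ∈ (0, 1)` and `m ≥ 1` the boundary is positive. -/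
def stoppingTime (H : Set (Matrix (Fin m) (Fin m) ℝ)) (α : ℝ) (x : ℕ → Fin m) : ℝ≥0∞ :=
  ⨅ (t : ℕ) (_ : 1 ≤ t ∧ ENNReal.ofReal (boundary α x t) ≤ statistic H x t), (t : ℝ≥0∞)

end MarkovTest

end

namespace MarkovTest

variable {m : ℕ}

/-- A harmonic function of an irreducible stochastic matrix is constant. -/
lemma harmonic_const {Q : Matrix (Fin m) (Fin m) ℝ} (hQ : Q ∈ Matrix.rowStochastic ℝ (Fin m))
    (hirr : Q.IsIrreducible) {g : Fin m → ℝ} (hg : Q *ᵥ g = g) (i j : Fin m) : g i = g j := by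
  have hpow : ∀ k : ℕ, (Q ^ k) *ᵥ g = g := by
    intro k
    induction k with
    | zero => simp
    | succ k ih => rw [pow_succ, ← Matrix.mulVec_mulVec, hg, ih]
  have : Nonempty (Fin m) := ⟨i⟩
  obtain ⟨x, hx⟩ := Finite.exists_max g
  have key : ∀ y, g y = g x := by
    intro y
    obtain ⟨k, -, hk⟩ := (Matrix.isIrreducible_iff_exists_pow_pos hirr.nonneg).1 hirr x y
    have hQk : Q ^ k ∈ Matrix.rowStochastic ℝ (Fin m) := pow_mem hQ k
    have h1 : ∑ z, (Q ^ k) x z * (g x - g z) = 0 := by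
      have h2 := congrFun (hpow k) x
      simp only [Matrix.mulVec, dotProduct] at h2
      simp only [mul_sub, Finset.sum_sub_distrib, ← Finset.sum_mul,
        Matrix.sum_row_of_mem_rowStochastic hQk, h2, one_mul, sub_self]
    have h3 := (Finset.sum_eq_zero_iff_of_nonneg fun z _ => mul_nonneg
      (Matrix.nonneg_of_mem_rowStochastic hQk) (sub_nonneg.2 (hx z))).1 h1 y (Finset.mem_univ y)
    rcases mul_eq_zero.1 h3 with h | h
    · exact absurd h hk.ne'
    · linarith
  rw [key i, key j]

/-- Solvability of the Poisson equation for an irreducible chain. -/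
lemma exists_poisson {Q : Matrix (Fin m) (Fin m) ℝ} {p : Fin m → ℝ}
    (hQ : Q ∈ Matrix.rowStochastic ℝ (Fin m)) (hirr : Q.IsIrreducible) (hp : IsStationary p Q)
    {f : Fin m → ℝ} (hf : p ⬝ᵥ f = 0) : ∃ g : Fin m → ℝ, g - Q *ᵥ g = f := by
  let L : (Fin m → ℝ) →ₗ[ℝ] (Fin m → ℝ) := Matrix.mulVecLin (1 - Q)
  let φ : Module.Dual ℝ (Fin m → ℝ) := dotProductBilin ℝ ℝ p
  have hφ : φ ≠ 0 := by
    intro h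
    have h1 : φ 1 = 0 := by rw [h]; rfl
    have h2 : φ 1 = 1 := by
      change p ⬝ᵥ 1 = 1
      rw [dotProduct_one]
      exact hp.mem_simplex.2
    linarith
  have hle : LinearMap.range L ≤ LinearMap.ker φ := by
    rintro _ ⟨g, rfl⟩
    change p ⬝ᵥ ((1 - Q) *ᵥ g) = 0
    rw [Matrix.sub_mulVec, dotProduct_sub, Matrix.one_mulVec, Matrix.dotProduct_mulVec,
      hp.vecMul_eq, sub_self]
  have hker : LinearMap.ker L ≤ Submodule.span ℝ {1} := by
    intro g hg
    have hg' : Q *ᵥ g = g := by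
      have : (1 - Q) *ᵥ g = 0 := hg
      rw [Matrix.sub_mulVec, Matrix.one_mulVec, sub_eq_zero] at this
      exact this.symm
    rw [Submodule.mem_span_singleton]
    rcases isEmpty_or_nonempty (Fin m) with h | ⟨⟨i⟩⟩
    · exact ⟨0, Subsingleton.elim _ _⟩
    · exact ⟨g i, funext fun j => by simp [harmonic_const hQ hirr hg' i j]⟩
  have h1 := Submodule.finrank_mono hker
  have h2 := finrank_span_le_card (R := ℝ) ({1} : Set (Fin m → ℝ))
  have h3 := L.finrank_range_add_finrank_ker
  have h4 := Module.Dual.finrank_ker_add_one_of_ne_zero hφ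
  simp only [Set.toFinset_singleton, Finset.card_singleton] at h2
  have heq := Submodule.eq_of_le_of_finrank_le hle (by omega)
  have hmem : f ∈ LinearMap.range L := by rw [heq]; exact hf
  obtain ⟨g, hg⟩ := hmem
  refine ⟨g, ?_⟩
  rw [← hg]
  change _ = (1 - Q) *ᵥ g
  rw [Matrix.sub_mulVec, Matrix.one_mulVec]

/-- The total weight of the paths of length `t` under a nonnegative kernel with row sums at most
`ρ`. -/
lemma sum_path_le {A : Fin m → Fin m → ℝ} {ν : Fin m → ℝ} {ρ : ℝ} (hA : ∀ x y, 0 ≤ A x y)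
    (hν : ∀ x, 0 ≤ ν x) (hρ : ∀ x, ∑ y, A x y ≤ ρ) (hρ0 : 0 ≤ ρ) (t : ℕ) :
    ∑ x : Fin (t + 1) → Fin m, ν (x 0) * ∏ s : Fin t, A (x s.castSucc) (x s.succ) ≤
      (∑ x, ν x) * ρ ^ t := by
  induction t with
  | zero =>
    rw [← (Equiv.funUnique (Fin 1) (Fin m)).symm.sum_comp]
    simp
  | succ t ih =>
    rw [← (Fin.snocEquiv fun _ : Fin (t + 1 + 1) => Fin m).sum_comp, Fintype.sum_prod_type,
      Finset.sum_comm]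
    calc _ = ∑ x : Fin (t + 1) → Fin m, (ν (x 0) * ∏ s : Fin t, A (x s.castSucc) (x s.succ)) *
            ∑ y, A (x (Fin.last t)) y := by
          refine Finset.sum_congr rfl fun x _ => ?_
          rw [Finset.mul_sum]
          refine Finset.sum_congr rfl fun y _ => ?_
          have h0 : (Fin.snocEquiv fun _ : Fin (t + 1 + 1) => Fin m) (y, x) =
            (Fin.snoc x y : Fin (t + 1 + 1) → Fin m) := rfl
          rw [h0, Fin.prod_univ_castSucc, ← mul_assoc]
          have h1 : (Fin.snoc x y : Fin (t + 1 + 1) → Fin m) 0 = x 0 := by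
            rw [← Fin.castSucc_zero, Fin.snoc_castSucc (α := fun _ => Fin m)]
          simp only [← Fin.castSucc_succ, Fin.succ_last,
            Fin.snoc_castSucc (α := fun _ => Fin m), Fin.snoc_last, h1]
      _ ≤ ∑ x : Fin (t + 1) → Fin m, (ν (x 0) * ∏ s : Fin t, A (x s.castSucc) (x s.succ)) * ρ :=
          Finset.sum_le_sum fun x _ => mul_le_mul_of_nonneg_left (hρ _)
            (mul_nonneg (hν _) (Finset.prod_nonneg fun s _ => hA _ _))
      _ ≤ _ := by
          rw [← Finset.sum_mul, pow_succ, ← mul_assoc]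
          exact mul_le_mul_of_nonneg_right ih hρ0

section Chain

variable {Ω : Type*} [MeasurableSpace Ω] {ℙ : Measure Ω} {X : ℕ → Ω → Fin m} {μ : Fin m → ℝ}
  {Q : Matrix (Fin m) (Fin m) ℝ}

lemma IsMarkovChain.measure_path (hX : IsMarkovChain ℙ X μ Q) (t : ℕ) (x : Fin (t + 1) → Fin m) :
    ℙ {ω | (fun s : Fin (t + 1) => X s ω) = x} =
      ENNReal.ofReal (μ (x 0) * ∏ s : Fin t, Q (x s.castSucc) (x s.succ)) := by
  have h := hX.law t fun s => x (Fin.ofNat (t + 1) s)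
  have hs : {ω | ∀ s ≤ t, X s ω = x (Fin.ofNat (t + 1) s)} =
      {ω | (fun s : Fin (t + 1) => X s ω) = x} := by
    ext ω
    simp only [Set.mem_ofPred_eq, funext_iff]
    constructor
    · intro h s
      rw [h s (Nat.lt_succ_iff.1 s.2)]
      simp
    · intro h s hs
      have := h (Fin.ofNat (t + 1) s)
      rwa [Fin.val_ofNat, Nat.mod_eq_of_lt (Nat.lt_succ_of_le hs)] at this
  rw [hs, Finset.prod_range] at h
  rw [h]
  congr 2
  refine Finset.prod_congr rfl fun s _ => ?_
  congr 2 <;> ext <;> simp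

/-- Chernoff bound for additive functionals of a Markov chain. -/
lemma IsMarkovChain.chernoff (hX : IsMarkovChain ℙ X μ Q)
    (hQ : Q ∈ Matrix.rowStochastic ℝ (Fin m)) (hμ : μ ∈ stdSimplex ℝ (Fin m))
    {F : Fin m → Fin m → ℝ} {ρ : ℝ} (hρ0 : 0 ≤ ρ) (hρ : ∀ x, ∑ y, Q x y * Real.exp (F x y) ≤ ρ)
    (t : ℕ) (a : ℝ) :
    ℙ {ω | a ≤ ∑ s ∈ Finset.range t, F (X s ω) (X (s + 1) ω)} ≤
      ENNReal.ofReal (Real.exp (-a) * ρ ^ t) := by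
  classical
  have hQ0 : ∀ x y, 0 ≤ Q x y := fun x y => Matrix.nonneg_of_mem_rowStochastic hQ
  let S : (Fin (t + 1) → Fin m) → ℝ := fun x => ∑ s : Fin t, F (x s.castSucc) (x s.succ)
  let w : (Fin (t + 1) → Fin m) → ℝ := fun x => μ (x 0) * ∏ s : Fin t, Q (x s.castSucc) (x s.succ)
  have hw : ∀ x, 0 ≤ w x := fun x =>
    mul_nonneg (hμ.1 _) (Finset.prod_nonneg fun s _ => hQ0 _ _)
  have hsub : {ω | a ≤ ∑ s ∈ Finset.range t, F (X s ω) (X (s + 1) ω)} ⊆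
      ⋃ x ∈ Finset.univ.filter fun x => a ≤ S x, {ω | (fun s : Fin (t + 1) => X s ω) = x} := by
    intro ω hω
    simp only [Set.mem_ofPred_eq, Finset.sum_range] at hω
    simp only [Set.mem_iUnion, Finset.mem_filter, Finset.mem_univ, true_and]
    exact ⟨fun s => X s ω, by simpa [S] using hω, rfl⟩
  calc _ ≤ ∑ x ∈ Finset.univ.filter fun x => a ≤ S x,
          ℙ {ω | (fun s : Fin (t + 1) => X s ω) = x} :=
        (measure_mono hsub).trans (measure_biUnion_finset_le _ _)
    _ = ∑ x ∈ Finset.univ.filter fun x => a ≤ S x, ENNReal.ofReal (w x) :=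
        Finset.sum_congr rfl fun x _ => hX.measure_path t x
    _ = ENNReal.ofReal (∑ x ∈ Finset.univ.filter fun x => a ≤ S x, w x) :=
        (ENNReal.ofReal_sum_of_nonneg fun x _ => hw x).symm
    _ ≤ _ := by
      apply ENNReal.ofReal_le_ofReal
      calc _ ≤ ∑ x ∈ Finset.univ.filter fun x => a ≤ S x, Real.exp (-a) * (w x * Real.exp (S x)) := by
            refine Finset.sum_le_sum fun x hx => ?_
            have h1 : 1 ≤ Real.exp (-a) * Real.exp (S x) := by
              rw [← Real.exp_add]
              exact Real.one_le_exp (by linarith [(Finset.mem_filter.1 hx).2])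
            nlinarith [hw x]
        _ ≤ ∑ x, Real.exp (-a) * (w x * Real.exp (S x)) :=
            Finset.sum_le_sum_of_subset_of_nonneg (Finset.filter_subset _ _) fun x _ _ =>
              mul_nonneg (Real.exp_pos _).le (mul_nonneg (hw x) (Real.exp_pos _).le)
        _ ≤ _ := by
            rw [← Finset.mul_sum]
            refine mul_le_mul_of_nonneg_left ?_ (Real.exp_pos _).le
            have h := sum_path_le (A := fun x y => Q x y * Real.exp (F x y)) (ν := μ)
              (fun x y => mul_nonneg (hQ0 x y) (Real.exp_pos _).le) hμ.1 hρ hρ0 t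
            rw [hμ.2, one_mul] at h
            refine le_trans (le_of_eq (Finset.sum_congr rfl fun x _ => ?_)) h
            simp only [w, S, Real.exp_sum, Finset.prod_mul_distrib, mul_assoc]

/-- Exponential concentration of additive functionals with stationary mean zero. -/
lemma IsMarkovChain.concentration (hX : IsMarkovChain ℙ X μ Q)
    (hQ : Q ∈ Matrix.rowStochastic ℝ (Fin m)) (hirr : Q.IsIrreducible)
    {p : Fin m → ℝ} (hp : IsStationary p Q) (hμ : μ ∈ stdSimplex ℝ (Fin m))
    {f : Fin m → Fin m → ℝ} (hf : ∑ x, p x * ∑ y, Q x y * f x y = 0) {δ : ℝ} (hδ : 0 < δ) :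
    ∑' t : ℕ, ℙ {ω | δ * t ≤ ∑ s ∈ Finset.range t, f (X s ω) (X (s + 1) ω)} ≠ ⊤ := by
  obtain ⟨g, hg⟩ := exists_poisson hQ hirr hp (f := fun x => ∑ y, Q x y * f x y) hf
  have hQ0 : ∀ x y, 0 ≤ Q x y := fun x y => Matrix.nonneg_of_mem_rowStochastic hQ
  have hQ1 : ∀ x, ∑ y, Q x y = 1 := fun x => Matrix.sum_row_of_mem_rowStochastic hQ x
  let F : Fin m → Fin m → ℝ := fun x y => f x y + g y - g x
  have hF0 : ∀ x, ∑ y, Q x y * F x y = 0 := by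
    intro x
    have h := congrFun hg x
    simp only [Pi.sub_apply, Matrix.mulVec, dotProduct] at h
    simp only [F, mul_sub, mul_add, Finset.sum_sub_distrib, Finset.sum_add_distrib,
      ← Finset.sum_mul, hQ1]
    linarith
  obtain ⟨B, hB1, hBδ, hB⟩ : ∃ B : ℝ, 1 ≤ B ∧ δ ≤ B ∧ ∀ x y, |F x y| ≤ B := by
    obtain ⟨B, hB⟩ := (Set.finite_range fun z : Fin m × Fin m => |F z.1 z.2|).bddAbove
    exact ⟨max B (max 1 δ), by simp, by simp, fun x y =>
      le_max_of_le_left (hB ⟨(x, y), rfl⟩)⟩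
  obtain ⟨G, hG⟩ : ∃ G : ℝ, ∀ x, |g x| ≤ G := by
    obtain ⟨G, hG⟩ := (Set.finite_range fun x => |g x|).bddAbove
    exact ⟨G, fun x => hG ⟨x, rfl⟩⟩
  have hBpos : 0 < B := by linarith
  set l : ℝ := δ / (2 * B ^ 2) with hl
  have hlpos : 0 < l := by positivity
  have hlB : l * B ≤ 1 := by
    rw [hl, div_mul_eq_mul_div, div_le_one (by positivity)]
    nlinarith
  have hlδ : l * B ^ 2 = δ / 2 := by rw [hl]; field_simp
  have hρ : ∀ x, ∑ y, Q x y * Real.exp (l * F x y) ≤ Real.exp (l ^ 2 * B ^ 2) := by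
    intro x
    have h1 : ∀ y, Q x y * Real.exp (l * F x y) ≤
        Q x y * (1 + l ^ 2 * B ^ 2) + l * (Q x y * F x y) := by
      intro y
      have hz : |l * F x y| ≤ l * B := by
        rw [abs_mul, abs_of_pos hlpos]
        exact mul_le_mul_of_nonneg_left (hB x y) hlpos.le
      have h2 := (abs_le.1 (Real.abs_exp_sub_one_sub_id_le (hz.trans hlB))).2
      have h3 : (l * F x y) ^ 2 ≤ (l * B) ^ 2 := sq_le_sq' (abs_le.1 hz).1 (abs_le.1 hz).2
      have h4 : Real.exp (l * F x y) ≤ 1 + l ^ 2 * B ^ 2 + l * F x y := by nlinarith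
      calc _ ≤ Q x y * (1 + l ^ 2 * B ^ 2 + l * F x y) :=
            mul_le_mul_of_nonneg_left h4 (hQ0 x y)
        _ = _ := by ring
    calc _ ≤ ∑ y, (Q x y * (1 + l ^ 2 * B ^ 2) + l * (Q x y * F x y)) :=
          Finset.sum_le_sum fun y _ => h1 y
      _ = 1 + l ^ 2 * B ^ 2 := by
          rw [Finset.sum_add_distrib, ← Finset.sum_mul, ← Finset.mul_sum, hQ1, hF0]
          ring
      _ ≤ _ := by linarith [Real.add_one_le_exp (l ^ 2 * B ^ 2)]
  have hbound : ∀ t : ℕ, ℙ {ω | δ * t ≤ ∑ s ∈ Finset.range t, f (X s ω) (X (s + 1) ω)} ≤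
      ENNReal.ofReal (Real.exp (l * (2 * G)) * Real.exp (-(l * δ / 2)) ^ t) := by
    intro t
    refine (measure_mono ?_).trans ((hX.chernoff hQ hμ (F := fun x y => l * F x y)
      (Real.exp_pos _).le hρ t (l * (δ * t - 2 * G))).trans (ENNReal.ofReal_le_ofReal ?_))
    · intro ω hω
      simp only [Set.mem_ofPred_eq] at hω ⊢
      rw [← Finset.mul_sum]
      refine mul_le_mul_of_nonneg_left ?_ hlpos.le
      have h1 : ∑ s ∈ Finset.range t, F (X s ω) (X (s + 1) ω) =
          ∑ s ∈ Finset.range t, f (X s ω) (X (s + 1) ω) + (g (X t ω) - g (X 0 ω)) := by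
        rw [← Finset.sum_range_sub (fun s => g (X s ω)), ← Finset.sum_add_distrib]
        exact Finset.sum_congr rfl fun s _ => by simp only [F]; ring
      rw [h1]
      have := abs_le.1 (hG (X t ω))
      have := abs_le.1 (hG (X 0 ω))
      linarith
    · rw [← Real.exp_nat_mul, ← Real.exp_nat_mul, ← Real.exp_add, ← Real.exp_add]
      apply Real.exp_le_exp.2
      have : l ^ 2 * B ^ 2 = l * (δ / 2) := by rw [← hlδ]; ring
      rw [this]
      apply le_of_eq
      ring
  refine ne_top_of_le_ne_top ?_ (ENNReal.tsum_le_tsum hbound)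
  have hr : Real.exp (-(l * δ / 2)) < 1 := by
    rw [Real.exp_lt_one_iff]
    have := mul_pos hlpos hδ
    linarith
  exact ((summable_geometric_of_lt_one (Real.exp_pos _).le hr).mul_left _).tsum_ofReal_ne_top

end Chain

lemma transCount_eq_sum (x : ℕ → Fin m) (t : ℕ) (u v : Fin m) :
    (transCount x t u v : ℝ) = ∑ s ∈ Finset.range t, if x s = u ∧ x (s + 1) = v then 1 else 0 := by
  rw [transCount, Finset.sum_boole]

lemma sum_transCount (x : ℕ → Fin m) (t : ℕ) (u : Fin m) :
    ∑ v, transCount x t u v = visitCount x t u := by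
  simp only [transCount, visitCount, Finset.card_filter]
  rw [Finset.sum_comm]
  refine Finset.sum_congr rfl fun s _ => ?_
  by_cases h : x s = u <;> simp [h]

lemma visitCount_le (x : ℕ → Fin m) (t : ℕ) (u : Fin m) : visitCount x t u ≤ t :=
  (Finset.card_filter_le _ _).trans (Finset.card_range t).le

lemma empirical_nonneg (x : ℕ → Fin m) (t : ℕ) (u v : Fin m) : 0 ≤ empirical x t u v := by
  unfold empirical
  split_ifs <;> positivity

lemma sum_empirical (x : ℕ → Fin m) (t : ℕ) (u : Fin m) : ∑ v, empirical x t u v = 1 := by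
  unfold empirical
  split_ifs with h
  · rw [← Finset.sum_div, ← Nat.cast_sum, sum_transCount, div_self]
    exact_mod_cast h.ne'
  · have : (m : ℝ) ≠ 0 := by exact_mod_cast (Fin.pos u).ne'
    simp [this]

lemma visitCount_mul_empirical (x : ℕ → Fin m) (t : ℕ) (u v : Fin m) :
    (visitCount x t u : ℝ) * empirical x t u v = transCount x t u v := by
  unfold empirical
  split_ifs with h
  · have : (visitCount x t u : ℝ) ≠ 0 := by exact_mod_cast h.ne'
    field_simp
  · have h0 : visitCount x t u = 0 := by omega
    have h1 : transCount x t u v ≤ visitCount x t u :=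
      (Finset.single_le_sum (f := fun v => transCount x t u v) (fun _ _ => Nat.zero_le _)
        (Finset.mem_univ v)).trans (sum_transCount x t u).le
    have h2 : transCount x t u v = 0 := by omega
    simp [h0, h2]

/-- Exceptional paths, on which the pair frequencies after `t` transitions are not yet within `δ` of
their stationary values. -/
def badPath (p : Fin m → ℝ) (Q : Matrix (Fin m) (Fin m) ℝ) (δ : ℝ) (t : ℕ) (x : ℕ → Fin m) :
    Prop :=
  ∃ u v, δ * t ≤ |(transCount x t u v : ℝ) - t * (p u * Q u v)|

lemma IsMarkovChain.tsum_badPath_ne_top {Ω : Type*} [MeasurableSpace Ω] {ℙ : Measure Ω}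
    {X : ℕ → Ω → Fin m} {μ : Fin m → ℝ} {Q : Matrix (Fin m) (Fin m) ℝ}
    (hX : IsMarkovChain ℙ X μ Q)
    (hQ : Q ∈ Matrix.rowStochastic ℝ (Fin m)) (hirr : Q.IsIrreducible)
    {p : Fin m → ℝ} (hp : IsStationary p Q) (hμ : μ ∈ stdSimplex ℝ (Fin m)) {δ : ℝ} (hδ : 0 < δ) :
    ∑' t : ℕ, ℙ {ω | badPath p Q δ t fun s => X s ω} ≠ ⊤ := by
  let f : Fin m → Fin m → Fin m → Fin m → ℝ := fun u v x y =>
    (if x = u ∧ y = v then 1 else 0) - p u * Q u v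
  let E : ℕ → Fin m → Fin m → Set Ω := fun t u v =>
    {ω | δ * t ≤ ∑ s ∈ Finset.range t, f u v (X s ω) (X (s + 1) ω)}
  let E' : ℕ → Fin m → Fin m → Set Ω := fun t u v =>
    {ω | δ * t ≤ ∑ s ∈ Finset.range t, -f u v (X s ω) (X (s + 1) ω)}
  have hf : ∀ u v, ∑ x, p x * ∑ y, Q x y * f u v x y = 0 := by
    intro u v
    have h1 : ∀ x, ∑ y, Q x y * f u v x y = (if x = u then Q x v else 0) - p u * Q u v := by
      intro x
      simp only [f, mul_sub, Finset.sum_sub_distrib, ← Finset.sum_mul,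
        Matrix.sum_row_of_mem_rowStochastic hQ, one_mul]
      by_cases h : x = u <;> simp [h]
    simp only [h1, mul_sub, Finset.sum_sub_distrib, ← Finset.sum_mul, hp.mem_simplex.2]
    simp
  have hE : ∀ u v, ∑' t, ℙ (E t u v) ≠ ⊤ := fun u v =>
    hX.concentration hQ hirr hp hμ (hf u v) hδ
  have hE' : ∀ u v, ∑' t, ℙ (E' t u v) ≠ ⊤ := fun u v =>
    hX.concentration hQ hirr hp hμ (f := fun x y => -f u v x y)
      (by simpa only [mul_neg, Finset.sum_neg_distrib, neg_eq_zero] using hf u v) hδ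
  have hle : ∀ t, ℙ {ω | badPath p Q δ t fun s => X s ω} ≤
      ∑ u, ∑ v, (ℙ (E t u v) + ℙ (E' t u v)) := by
    intro t
    have hsub : {ω | badPath p Q δ t fun s => X s ω} ⊆
        ⋃ u ∈ (Finset.univ : Finset (Fin m)), ⋃ v ∈ (Finset.univ : Finset (Fin m)),
          (E t u v ∪ E' t u v) := by
      rintro ω ⟨u, v, h⟩
      simp only [Set.mem_iUnion, Finset.mem_univ, exists_const]
      refine ⟨u, v, ?_⟩
      have h1 : ∑ s ∈ Finset.range t, f u v (X s ω) (X (s + 1) ω) =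
          (transCount (fun s => X s ω) t u v : ℝ) - t * (p u * Q u v) := by
        simp only [f, Finset.sum_sub_distrib, transCount_eq_sum]
        simp
      rcases le_abs.1 h with h | h
      · left
        simp only [E, Set.mem_ofPred_eq]
        rwa [h1]
      · right
        simp only [E', Set.mem_ofPred_eq]
        rwa [Finset.sum_neg_distrib, h1]
    refine (measure_mono hsub).trans ((measure_biUnion_finset_le _ _).trans ?_)
    refine Finset.sum_le_sum fun u _ => (measure_biUnion_finset_le _ _).trans ?_
    exact Finset.sum_le_sum fun v _ => measure_union_le _ _
  refine ne_top_of_le_ne_top ?_ (ENNReal.tsum_le_tsum hle)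
  rw [Summable.tsum_finsetSum fun _ _ => ENNReal.summable]
  refine ENNReal.sum_ne_top.2 fun u _ => ?_
  rw [Summable.tsum_finsetSum fun _ _ => ENNReal.summable]
  refine ENNReal.sum_ne_top.2 fun v _ => ?_
  rw [ENNReal.tsum_add]
  exact ENNReal.add_ne_top.2 ⟨hE u v, hE' u v⟩

/-- A continuous minorant of the divergence of a joint frequency matrix `w` from a transition
matrix `P`: the entries of `P` are increased by `δ`. -/
noncomputable def truncKL (δ : ℝ) (w P : Matrix (Fin m) (Fin m) ℝ) : ℝ :=
  ∑ u, ((∑ v, w u v * Real.log (w u v)) - (∑ v, w u v) * Real.log (∑ v, w u v) -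
    ∑ v, w u v * Real.log (|P u v| + δ))

lemma continuous_truncKL {δ : ℝ} (hδ : 0 < δ) :
    Continuous fun z : Matrix (Fin m) (Fin m) ℝ × Matrix (Fin m) (Fin m) ℝ =>
      truncKL δ z.1 z.2 := by
  have h1 : ∀ u v, Continuous fun z : Matrix (Fin m) (Fin m) ℝ × Matrix (Fin m) (Fin m) ℝ =>
      z.1 u v := fun u v => continuous_fst.matrix_elem u v
  have h2 : ∀ u v, Continuous fun z : Matrix (Fin m) (Fin m) ℝ × Matrix (Fin m) (Fin m) ℝ =>
      Real.log (|z.2 u v| + δ) := fun u v =>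
    ((continuous_snd.matrix_elem u v).abs.add continuous_const).log fun z =>
      (add_pos_of_nonneg_of_pos (abs_nonneg _) hδ).ne'
  unfold truncKL
  refine continuous_finsetSum _ fun u _ => (Continuous.sub ?_ ?_).sub ?_
  · exact continuous_finsetSum _ fun v _ => Real.continuous_mul_log.comp (h1 u v)
  · exact Real.continuous_mul_log.comp (continuous_finsetSum _ fun v _ => h1 u v)
  · exact continuous_finsetSum _ fun v _ => (h1 u v).mul (h2 u v)

lemma truncKL_anti {δ δ' : ℝ} (hδ : 0 < δ) (h : δ ≤ δ') {w P : Matrix (Fin m) (Fin m) ℝ}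
    (hw : ∀ u v, 0 ≤ w u v) : truncKL δ' w P ≤ truncKL δ w P := by
  refine Finset.sum_le_sum fun u _ => sub_le_sub_left (Finset.sum_le_sum fun v _ => ?_) _
  exact mul_le_mul_of_nonneg_left (Real.log_le_log (by positivity) (by linarith)) (hw u v)

lemma truncKL_scaled (δ : ℝ) (a : Fin m → ℝ) {q P : Matrix (Fin m) (Fin m) ℝ}
    (hq : ∀ u, ∑ v, q u v = 1) :
    truncKL δ (fun u v => a u * q u v) P =
      ∑ u, a u * ∑ v, q u v * (Real.log (q u v) - Real.log (|P u v| + δ)) := by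
  refine Finset.sum_congr rfl fun u _ => ?_
  have h1 : ∑ v, a u * q u v = a u := by rw [← Finset.mul_sum, hq, mul_one]
  have h2 : a u * Real.log (a u) = ∑ v, a u * q u v * Real.log (a u) := by
    rw [← Finset.sum_mul, h1]
  rw [h1, h2, ← Finset.sum_sub_distrib, ← Finset.sum_sub_distrib, Finset.mul_sum]
  refine Finset.sum_congr rfl fun v _ => ?_
  rcases eq_or_ne (a u) 0 with ha | ha
  · simp [ha]
  rcases eq_or_ne (q u v) 0 with hb | hb
  · simp [hb]
  rw [Real.log_mul ha hb]
  ring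

lemma sum_mul_log_div_ge {q p : Fin m → ℝ} {δ : ℝ} (hδ : 0 ≤ δ) (hq : ∀ v, 0 ≤ q v)
    (hp : ∀ v, 0 ≤ p v) (h : ∀ v, p v = 0 → q v = 0) :
    ∑ v, q v * (Real.log (q v) - Real.log (|p v| + δ)) ≤ ∑ v, q v * Real.log (q v / p v) := by
  refine Finset.sum_le_sum fun v _ => ?_
  rcases (hq v).eq_or_lt with h0 | h0
  · simp [← h0]
  have hpv : 0 < p v := (hp v).lt_of_ne fun e => h0.ne' (h v e.symm)
  rw [Real.log_div h0.ne' hpv.ne', abs_of_pos hpv]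
  have := Real.log_le_log hpv (by linarith : p v ≤ p v + δ)
  exact mul_le_mul_of_nonneg_left (by linarith) h0.le

lemma row_mem_stdSimplex {P : Matrix (Fin m) (Fin m) ℝ} (hP : P ∈ Matrix.rowStochastic ℝ (Fin m))
    (u : Fin m) : P u ∈ stdSimplex ℝ (Fin m) :=
  ⟨fun _ => Matrix.nonneg_of_mem_rowStochastic hP, Matrix.sum_row_of_mem_rowStochastic hP u⟩

/-- A weighted sum of divergences dominates the truncated divergence. -/
lemma ofReal_truncKL_le {δ : ℝ} (hδ : 0 ≤ δ) {a : Fin m → ℝ} (ha : ∀ u, 0 ≤ a u)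
    {q P : Matrix (Fin m) (Fin m) ℝ} (hq : ∀ u, q u ∈ stdSimplex ℝ (Fin m))
    (hP : P ∈ Matrix.rowStochastic ℝ (Fin m)) :
    ENNReal.ofReal (truncKL δ (fun u v => a u * q u v) P) ≤
      ∑ u, ENNReal.ofReal (a u) * kl (q u) (P u) := by
  rw [truncKL_scaled δ a fun u => (hq u).2]
  refine (Finset.le_sum_of_subadditive _ ENNReal.ofReal_zero.le (fun _ _ => ENNReal.ofReal_add_le) _ _).trans
    (Finset.sum_le_sum fun u _ => ?_)
  rw [ENNReal.ofReal_mul (ha u)]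
  refine mul_le_mul_right ?_ _
  unfold kl
  split_ifs with h
  · exact ENNReal.ofReal_le_ofReal (sum_mul_log_div_ge hδ (hq u).1 (row_mem_stdSimplex hP u).1 h)
  · exact le_top

lemma le_statistic {H : Set (Matrix (Fin m) (Fin m) ℝ)}
    (hH : H ⊆ Matrix.rowStochastic ℝ (Fin m)) {x : ℕ → Fin m} {t : ℕ} (ht : 0 < t) {c δ : ℝ}
    (hδ : 0 ≤ δ) (h : ∀ P ∈ H, c ≤ truncKL δ (fun u v => (transCount x t u v : ℝ) / t) P) :
    ENNReal.ofReal (c * t) ≤ statistic H x t := by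
  refine le_iInf₂ fun P hP => ?_
  have ht' : (0 : ℝ) < t := by exact_mod_cast ht
  have h1 : (fun u v => (transCount x t u v : ℝ) / t) =
      fun u v => ((visitCount x t u : ℝ) / t) * empirical x t u v := by
    funext u v
    rw [div_mul_eq_mul_div, visitCount_mul_empirical]
  have h2 := h P hP
  rw [h1] at h2
  have h3 := ofReal_truncKL_le hδ (a := fun u => (visitCount x t u : ℝ) / t)
    (fun u => by positivity) (q := empirical x t)
    (fun u => ⟨fun v => empirical_nonneg x t u v, sum_empirical x t u⟩) (hH hP)
  rw [mul_comm, ENNReal.ofReal_mul ht'.le]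
  calc _ ≤ ENNReal.ofReal t * ∑ u, ENNReal.ofReal ((visitCount x t u : ℝ) / t) *
          kl (empirical x t u) (P u) := by gcongr; exact (ENNReal.ofReal_le_ofReal h2).trans h3
    _ = ∑ u, (visitCount x t u : ℝ≥0∞) * kl (empirical x t u) (P u) := by
        rw [Finset.mul_sum]
        refine Finset.sum_congr rfl fun u _ => ?_
        rw [← mul_assoc, ← ENNReal.ofReal_mul ht'.le, mul_div_cancel₀ _ ht'.ne',
          ENNReal.ofReal_natCast]
    _ = _ := by
        rw [Finset.sum_filter]
        refine Finset.sum_congr rfl fun u _ => ?_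
        split_ifs with hu
        · rfl
        · simp [Nat.eq_zero_of_not_pos hu]

/-- If all truncated divergences are at most `c`, so is the stationary divergence. -/
lemma stationaryKL_le {p : Fin m → ℝ} {Q P : Matrix (Fin m) (Fin m) ℝ}
    (hp : ∀ u, 0 ≤ p u) (hQ : Q ∈ Matrix.rowStochastic ℝ (Fin m))
    (hP : P ∈ Matrix.rowStochastic ℝ (Fin m)) {c : ℝ}
    (h : ∀ n : ℕ, truncKL (1 / ((n : ℝ) + 1)) (fun u v => p u * Q u v) P ≤ c) :
    stationaryKL p Q P ≤ ENNReal.ofReal c := by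
  have hQ0 : ∀ u v, 0 ≤ Q u v := fun u v => Matrix.nonneg_of_mem_rowStochastic hQ
  have hP0 : ∀ u v, 0 ≤ P u v := fun u v => Matrix.nonneg_of_mem_rowStochastic hP
  have hδ : Tendsto (fun n : ℕ => 1 / ((n : ℝ) + 1)) atTop (𝓝 0) :=
    tendsto_one_div_add_atTop_nhds_zero_nat
  have habs : ∀ u v, P u v = 0 → p u * Q u v = 0 := by
    intro u v huv
    by_contra hne
    have hpos : 0 < p u * Q u v := (mul_nonneg (hp u) (hQ0 u v)).lt_of_ne' hne
    let A : ℝ := ∑ u, ((∑ v, p u * Q u v * Real.log (p u * Q u v)) -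
      (∑ v, p u * Q u v) * Real.log (∑ v, p u * Q u v))
    let R : ℝ := ∑ u, ∑ v, p u * Q u v * Real.log 2
    have hbd : ∀ n : ℕ, A - R - c ≤ p u * Q u v * Real.log (1 / ((n : ℝ) + 1)) := by
      intro n
      have hn : 1 / ((n : ℝ) + 1) ≤ 1 := by
        rw [div_le_one (by positivity)]
        linarith [(Nat.cast_nonneg n : (0 : ℝ) ≤ n)]
      have hn0 : (0 : ℝ) < 1 / ((n : ℝ) + 1) := by positivity
      have h1 : A - ∑ u, ∑ v, p u * Q u v * Real.log (|P u v| + 1 / ((n : ℝ) + 1)) ≤ c := by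
        have := h n
        unfold truncKL at this
        rwa [Finset.sum_sub_distrib] at this
      have h2 : 0 ≤ R - ∑ u, ∑ v, p u * Q u v * Real.log (|P u v| + 1 / ((n : ℝ) + 1)) +
          p u * Q u v * Real.log (1 / ((n : ℝ) + 1)) := by
        have hterm : ∀ u v, 0 ≤ p u * Q u v * Real.log 2 -
            p u * Q u v * Real.log (|P u v| + 1 / ((n : ℝ) + 1)) := by
          intro u v
          rw [← mul_sub]
          refine mul_nonneg (mul_nonneg (hp u) (hQ0 u v)) (sub_nonneg.2 ?_)
          refine Real.log_le_log (by positivity) ?_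
          rw [abs_of_nonneg (hP0 u v)]
          linarith [Matrix.le_one_of_mem_rowStochastic hP (i := u) (j := v)]
        have h3 : p u * Q u v * Real.log 2 -
            p u * Q u v * Real.log (|P u v| + 1 / ((n : ℝ) + 1)) ≤
            ∑ u, ∑ v, (p u * Q u v * Real.log 2 -
              p u * Q u v * Real.log (|P u v| + 1 / ((n : ℝ) + 1))) :=
          (Finset.single_le_sum (f := fun v => p u * Q u v * Real.log 2 -
              p u * Q u v * Real.log (|P u v| + 1 / ((n : ℝ) + 1))) (fun v _ => hterm u v)
              (Finset.mem_univ v)).trans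
            (Finset.single_le_sum (f := fun u => ∑ v, (p u * Q u v * Real.log 2 -
              p u * Q u v * Real.log (|P u v| + 1 / ((n : ℝ) + 1))))
              (fun u _ => Finset.sum_nonneg fun v _ => hterm u v) (Finset.mem_univ u))
        simp only [Finset.sum_sub_distrib] at h3
        rw [huv, abs_zero, zero_add] at h3
        have h4 : 0 ≤ p u * Q u v * Real.log 2 := mul_nonneg hpos.le (Real.log_nonneg one_le_two)
        change 0 ≤ (∑ u, ∑ v, p u * Q u v * Real.log 2) - _ + _
        linarith
      linarith
    have hlim : Tendsto (fun n : ℕ => p u * Q u v * Real.log (1 / ((n : ℝ) + 1))) atTop atBot := by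
      refine Tendsto.const_mul_atBot hpos (Real.tendsto_log_nhdsGT_zero.comp ?_)
      exact tendsto_nhdsWithin_iff.2 ⟨hδ, Eventually.of_forall fun n => by
        change (0 : ℝ) < _; positivity⟩
    obtain ⟨n, hn⟩ := (hlim.eventually (eventually_lt_atBot (A - R - c))).exists
    linarith [hbd n]
  have hlim : Tendsto (fun n : ℕ => truncKL (1 / ((n : ℝ) + 1)) (fun u v => p u * Q u v) P) atTop
      (𝓝 (∑ u, p u * ∑ v, Q u v * Real.log (Q u v / P u v))) := by
    simp only [truncKL_scaled _ p (Matrix.sum_row_of_mem_rowStochastic hQ), Finset.mul_sum]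
    refine tendsto_finsetSum _ fun u _ => tendsto_finsetSum _ fun v _ => ?_
    rcases (mul_nonneg (hp u) (hQ0 u v)).eq_or_lt with h0 | h0
    · simp only [← mul_assoc, ← h0, zero_mul]
      exact tendsto_const_nhds
    · have hPuv : 0 < P u v := (hP0 u v).lt_of_ne fun e => h0.ne' (habs u v e.symm)
      have hQuv : Q u v ≠ 0 := fun e => by simp [e] at h0
      rw [Real.log_div hQuv hPuv.ne']
      refine ((tendsto_const_nhds.sub (Tendsto.log ?_ hPuv.ne')).const_mul _).const_mul _
      simpa [abs_of_pos hPuv] using hδ.const_add |P u v|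
  have hle := le_of_tendsto' hlim h
  refine le_trans (le_of_eq ?_) (ENNReal.ofReal_le_ofReal hle)
  have hterm : ∀ u, 0 ≤ p u * ∑ v, Q u v * Real.log (Q u v / P u v) := by
    intro u
    rcases (hp u).eq_or_lt with h0 | h0
    · simp [← h0]
    · exact mul_nonneg h0.le (kl_sum_nonneg (row_mem_stdSimplex hQ u) (row_mem_stdSimplex hP u)
        fun v hv => (mul_eq_zero.1 (habs u v hv)).resolve_left h0.ne')
  rw [ENNReal.ofReal_sum_of_nonneg fun u _ => hterm u]
  refine Finset.sum_congr rfl fun u _ => ?_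
  rw [ENNReal.ofReal_mul (hp u)]
  rcases (hp u).eq_or_lt with h0 | h0
  · simp [← h0]
  · rw [kl, if_pos fun v hv => (mul_eq_zero.1 (habs u v hv)).resolve_left h0.ne']

/-- Near the stationary pair frequencies the truncated divergence from a compact class stays above
any level below the stationary divergence. -/
lemma exists_truncKL_gt {p : Fin m → ℝ} {Q : Matrix (Fin m) (Fin m) ℝ}
    (hp : ∀ u, 0 ≤ p u) (hQ : Q ∈ Matrix.rowStochastic ℝ (Fin m))
    {H : Set (Matrix (Fin m) (Fin m) ℝ)} (hH : H ⊆ Matrix.rowStochastic ℝ (Fin m))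
    (hHc : IsCompact H) {c : ℝ} (hc : ENNReal.ofReal c < stationaryKLInf p Q H) :
    ∃ δ > 0, ∀ w : Matrix (Fin m) (Fin m) ℝ, (∀ u v, 0 ≤ w u v) →
      (∀ u v, |w u v - p u * Q u v| ≤ δ) → ∀ P ∈ H, c ≤ truncKL δ w P := by
  by_contra! hcon
  let K : ℕ → Set (Matrix (Fin m) (Fin m) ℝ × Matrix (Fin m) (Fin m) ℝ) := fun n =>
    {z | ((∀ u v, 0 ≤ z.1 u v) ∧ (∀ u v, |z.1 u v - p u * Q u v| ≤ 1 / ((n : ℝ) + 1))) ∧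
      z.2 ∈ H ∧ truncKL (1 / ((n : ℝ) + 1)) z.1 z.2 ≤ c}
  have hpos : ∀ n : ℕ, (0 : ℝ) < 1 / ((n : ℝ) + 1) := fun n => by positivity
  have hcl : ∀ n, IsClosed (K n) := by
    intro n
    have h1 : ∀ u v, Continuous fun z : Matrix (Fin m) (Fin m) ℝ × Matrix (Fin m) (Fin m) ℝ =>
      z.1 u v := fun u v => continuous_fst.matrix_elem u v
    refine IsClosed.and (IsClosed.and ?_ ?_) (IsClosed.and ?_ ?_)
    · simp only [Set.ofPred_forall]
      exact isClosed_iInter fun u => isClosed_iInter fun v =>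
        isClosed_le continuous_const (h1 u v)
    · simp only [Set.ofPred_forall]
      exact isClosed_iInter fun u => isClosed_iInter fun v =>
        isClosed_le ((h1 u v).sub continuous_const).abs continuous_const
    · exact hHc.isClosed.preimage continuous_snd
    · exact isClosed_le (continuous_truncKL (hpos n)) continuous_const
  have hne : (⋂ n, K n).Nonempty := by
    refine IsCompact.nonempty_iInter_of_sequence_nonempty_isCompact_isClosed K ?_ ?_ ?_ hcl
    · rintro n z ⟨⟨h0, h1⟩, h2, h3⟩
      have hle : 1 / (((n + 1 : ℕ) : ℝ) + 1) ≤ 1 / ((n : ℝ) + 1) :=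
        one_div_le_one_div_of_le (by positivity) (by push_cast; linarith)
      exact ⟨⟨h0, fun u v => (h1 u v).trans hle⟩, h2, (truncKL_anti (hpos _) hle h0).trans h3⟩
    · intro n
      obtain ⟨w, h0, h1, P, hP, h2⟩ := hcon _ (hpos n)
      exact ⟨(w, P), ⟨h0, h1⟩, hP, h2.le⟩
    · let B : Set (Matrix (Fin m) (Fin m) ℝ) :=
        Set.pi Set.univ fun u => Set.pi Set.univ fun v => Set.Icc (p u * Q u v - 1) (p u * Q u v + 1)
      have hB : IsCompact B :=
        isCompact_univ_pi fun u => isCompact_univ_pi fun v => isCompact_Icc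
      refine (hB.prod hHc).of_isClosed_subset (hcl 0) ?_
      rintro z ⟨⟨-, h1⟩, h2, -⟩
      refine ⟨fun u _ v _ => ?_, h2⟩
      have := abs_le.1 (h1 u v)
      simp only [Nat.cast_zero, zero_add, div_one] at this
      constructor <;> linarith
  obtain ⟨⟨w, P⟩, hz⟩ := hne
  rw [Set.mem_iInter] at hz
  have hw : w = fun u v => p u * Q u v := by
    funext u v
    have h1 : |w u v - p u * Q u v| ≤ 0 :=
      ge_of_tendsto' tendsto_one_div_add_atTop_nhds_zero_nat fun n => (hz n).1.2 u v
    linarith [abs_nonpos_iff.1 h1]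
  subst hw
  have hP : P ∈ H := (hz 0).2.1
  have h1 := stationaryKL_le hp hQ (hH hP) fun n => (hz n).2.2
  exact absurd (hc.trans_le (iInf₂_le P hP)) (not_lt.2 h1)

lemma isCompact_nullClass (π : Fin m → ℝ) : IsCompact (nullClass π) := by
  let B : Set (Matrix (Fin m) (Fin m) ℝ) :=
    Set.pi Set.univ fun _ => Set.pi Set.univ fun _ => Set.Icc 0 1
  have hB : IsCompact B := isCompact_univ_pi fun u => isCompact_univ_pi fun v => isCompact_Icc
  have h1 : ∀ u v, Continuous fun P : Matrix (Fin m) (Fin m) ℝ => P u v := fun u v =>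
    continuous_id.matrix_elem u v
  have hset : nullClass π = {P | ((∀ u v, 0 ≤ P u v) ∧ ∀ u, ∑ v, P u v = 1) ∧ π ᵥ* P = π} := by
    ext P
    exact and_congr_left' Matrix.mem_rowStochastic_iff_sum
  refine hB.of_isClosed_subset ?_ ?_
  · rw [hset]
    refine IsClosed.and (IsClosed.and ?_ ?_) ?_
    · simp only [Set.ofPred_forall]
      exact isClosed_iInter fun u => isClosed_iInter fun v =>
        isClosed_le continuous_const (h1 u v)
    · simp only [Set.ofPred_forall]
      exact isClosed_iInter fun u =>
        isClosed_eq (continuous_finsetSum _ fun v _ => h1 u v) continuous_const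
    · exact isClosed_eq (Continuous.matrix_vecMul continuous_const continuous_id) continuous_const
  · intro P hP u _ v _
    exact ⟨Matrix.nonneg_of_mem_rowStochastic hP.1, Matrix.le_one_of_mem_rowStochastic hP.1⟩

/-- The exploration term of the boundary is eventually below any linear function. -/
lemma exists_psi_le (hm : 0 < m) {η : ℝ} (hη : 0 < η) :
    ∃ t₁ : ℕ, ∀ t ≥ t₁, ∀ x : ℕ → Fin m, ((m : ℝ) - 1) * psi x t ≤ η * t := by
  have hm1 : (1 : ℝ) ≤ m := by exact_mod_cast hm
  rcases hm1.eq_or_lt with h1 | h1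
  · exact ⟨0, fun t _ x => by rw [← h1, sub_self, zero_mul]; positivity⟩
  have hr : 0 < (m : ℝ) - 1 := by linarith
  have hm0 : (0 : ℝ) < m := by linarith
  set a : ℝ := η / (2 * m) with ha
  have hapos : 0 < a := by positivity
  set C : ℝ := ((m : ℝ) - 1) * m * (a - Real.log a) with hC
  obtain ⟨t₁, ht₁⟩ := exists_nat_ge (2 * C / η)
  refine ⟨t₁, fun t ht x => ?_⟩
  have hlog : ∀ z : ℝ, 0 < z → Real.log z ≤ a * z - 1 - Real.log a := by
    intro z hz
    have := Real.log_le_sub_one_of_pos (mul_pos hapos hz)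
    rw [Real.log_mul hapos.ne' hz.ne'] at this
    linarith
  have hterm : ∀ u, Real.log (Real.exp 1 * (1 + (visitCount x t u : ℝ) / ((m : ℝ) - 1))) ≤
      a * (1 + t / ((m : ℝ) - 1)) - Real.log a := by
    intro u
    have hpos : 0 < 1 + (visitCount x t u : ℝ) / ((m : ℝ) - 1) := by positivity
    rw [Real.log_mul (Real.exp_pos 1).ne' hpos.ne', Real.log_exp]
    have h2 : 1 + (visitCount x t u : ℝ) / ((m : ℝ) - 1) ≤ 1 + t / ((m : ℝ) - 1) := by
      gcongr
      exact visitCount_le x t u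
    have h3 := mul_le_mul_of_nonneg_left h2 hapos.le
    linarith [hlog _ hpos]
  have hsum : psi x t ≤ m * (a * (1 + t / ((m : ℝ) - 1)) - Real.log a) := by
    refine (Finset.sum_le_sum fun u _ => hterm u).trans (le_of_eq ?_)
    rw [Finset.sum_const, Finset.card_univ, Fintype.card_fin, nsmul_eq_mul]
  have h4 : 2 * C / η ≤ t := ht₁.trans (by exact_mod_cast ht)
  rw [div_le_iff₀ hη] at h4
  calc _ ≤ ((m : ℝ) - 1) * (m * (a * (1 + t / ((m : ℝ) - 1)) - Real.log a)) :=
        mul_le_mul_of_nonneg_left hsum hr.le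
    _ = C + (m * a) * t := by rw [hC]; field_simp; ring
    _ = C + η / 2 * t := by rw [ha]; congr 2; field_simp
    _ ≤ _ := by linarith

/-- Off the exceptional paths the test has stopped as soon as the drift beats the boundary. -/
lemma boundary_le_statistic {p : Fin m → ℝ} {Q : Matrix (Fin m) (Fin m) ℝ}
    {H : Set (Matrix (Fin m) (Fin m) ℝ)} (hH : H ⊆ Matrix.rowStochastic ℝ (Fin m)) {c δ : ℝ}
    (hδ : 0 ≤ δ)
    (h : ∀ w : Matrix (Fin m) (Fin m) ℝ, (∀ u v, 0 ≤ w u v) →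
      (∀ u v, |w u v - p u * Q u v| ≤ δ) → ∀ P ∈ H, c ≤ truncKL δ w P)
    {x : ℕ → Fin m} {t : ℕ} (ht : 0 < t) (hx : ¬ badPath p Q δ t x) {α : ℝ}
    (hb : boundary α x t ≤ c * t) : ENNReal.ofReal (boundary α x t) ≤ statistic H x t := by
  refine (ENNReal.ofReal_le_ofReal hb).trans (le_statistic hH ht hδ fun P hP => ?_)
  have ht' : (0 : ℝ) < t := by exact_mod_cast ht
  refine h _ (fun u v => by positivity) (fun u v => ?_) P hP
  simp only [badPath, not_exists, not_le] at hx
  have h1 : (transCount x t u v : ℝ) / t - p u * Q u v =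
      ((transCount x t u v : ℝ) - t * (p u * Q u v)) / t := by field_simp
  rw [h1, abs_div, abs_of_pos ht', div_le_iff₀ ht']
  exact (hx u v).le

open Classical in
lemma stoppingTime_le {H : Set (Matrix (Fin m) (Fin m) ℝ)} {α : ℝ} {x : ℕ → Fin m}
    {bad : ℕ → Prop} {T : ℕ} (hT : 1 ≤ T)
    (h : ∀ t ≥ T, ¬ bad t → ENNReal.ofReal (boundary α x t) ≤ statistic H x t) :
    stoppingTime H α x ≤ T + ∑' t, if bad t then (1 : ℝ≥0∞) else 0 := by
  have hcount : ∀ n : ℕ, (∀ t, T ≤ t → t < T + n → bad t) →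
      (n : ℝ≥0∞) ≤ ∑' t, if bad t then (1 : ℝ≥0∞) else 0 := by
    intro n hn
    calc (n : ℝ≥0∞) = ∑ t ∈ Finset.Ico T (T + n), if bad t then (1 : ℝ≥0∞) else 0 := by
          rw [Finset.sum_congr rfl fun t ht => if_pos
            (hn t (Finset.mem_Ico.1 ht).1 (Finset.mem_Ico.1 ht).2)]
          simp
      _ ≤ _ := ENNReal.sum_le_tsum _
  by_cases hex : ∃ n, ¬ bad (T + n)
  · have hle : stoppingTime H α x ≤ ((T + Nat.find hex : ℕ) : ℝ≥0∞) :=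
      iInf₂_le _ ⟨by omega, h _ (by omega) (Nat.find_spec hex)⟩
    refine hle.trans ?_
    rw [Nat.cast_add]
    gcongr
    refine hcount _ fun t h1 h2 => ?_
    have := Nat.find_min hex (m := t - T) (by omega)
    rwa [not_not, Nat.add_sub_cancel' h1] at this
  · push Not at hex
    have htop : ∑' t, (if bad t then (1 : ℝ≥0∞) else 0) = ⊤ := by
      by_contra hne
      obtain ⟨n, hn⟩ := ENNReal.exists_nat_gt hne
      refine absurd (hcount n fun t h1 _ => ?_) (not_le.2 hn)
      have := hex (t - T)
      rwa [Nat.add_sub_cancel' h1] at this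
    rw [htop, add_top]
    exact le_top

open Classical in
lemma lintegral_stoppingTime_le {Ω : Type*} [MeasurableSpace Ω] {ℙ : Measure Ω}
    [IsProbabilityMeasure ℙ] {X : ℕ → Ω → Fin m} {H : Set (Matrix (Fin m) (Fin m) ℝ)} {α : ℝ}
    {bad : ℕ → (ℕ → Fin m) → Prop} {T : ℕ} (hT : 1 ≤ T)
    (h : ∀ x, ∀ t ≥ T, ¬ bad t x → ENNReal.ofReal (boundary α x t) ≤ statistic H x t) :
    ∫⁻ ω, stoppingTime H α (fun t => X t ω) ∂ℙ ≤
      T + ∑' t, ℙ {ω | bad t fun s => X s ω} := by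
  let B : ℕ → Set Ω := fun t => toMeasurable ℙ {ω | bad t fun s => X s ω}
  have hB : ∀ t, MeasurableSet (B t) := fun t => measurableSet_toMeasurable _ _
  calc _ ≤ ∫⁻ ω, ((T : ℝ≥0∞) + ∑' t, (B t).indicator 1 ω) ∂ℙ := by
        refine lintegral_mono fun ω => (stoppingTime_le hT (h fun t => X t ω)).trans ?_
        gcongr with t
        split_ifs with hb
        · have : ω ∈ B t := subset_toMeasurable ℙ _ hb
          simp [this]
        · exact zero_le
    _ = T + ∑' t, ℙ (B t) := by
        rw [lintegral_add_left measurable_const, lintegral_const, measure_univ, mul_one,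
          lintegral_tsum fun t => (measurable_one.indicator (hB t)).aemeasurable]
        simp only [lintegral_indicator_one (hB _)]
    _ = _ := by simp only [B, measure_toMeasurable]

/-- An affine bound `a * log (1 / α) + C` gives the asymptotic rate `a`. -/
lemma limsup_div_log_le {f : ℝ → ℝ≥0∞} {a C : ℝ}
    (h : ∀ α : ℝ, 0 < α → α < 1 → f α ≤ ENNReal.ofReal (a * Real.log (1 / α) + C)) :
    limsup (fun α : ℝ => f α / ENNReal.ofReal (Real.log (1 / α))) (𝓝[>] 0) ≤
      ENNReal.ofReal a := by
  have hlog : Tendsto (fun α : ℝ => Real.log (1 / α)) (𝓝[>] 0) atTop := by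
    simp only [one_div]
    exact Real.tendsto_log_atTop.comp tendsto_inv_nhdsGT_zero
  have hlim : Tendsto (fun α : ℝ => ENNReal.ofReal (a + C / Real.log (1 / α))) (𝓝[>] 0)
      (𝓝 (ENNReal.ofReal a)) := by
    refine ENNReal.tendsto_ofReal ?_
    simpa using (hlog.const_div_atTop C).const_add a
  rw [← hlim.limsup_eq]
  refine limsup_le_limsup ?_
  filter_upwards [Ioo_mem_nhdsGT (zero_lt_one (α := ℝ))] with α hα
  have hl : 0 < Real.log (1 / α) := Real.log_pos (by rw [lt_div_iff₀ hα.1]; linarith [hα.2])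
  have he : a + C / Real.log (1 / α) = (a * Real.log (1 / α) + C) / Real.log (1 / α) := by
    field_simp
  rw [he, ENNReal.ofReal_div_of_pos hl]
  exact ENNReal.div_le_div_right (h α hα.1 hα.2) _

/-- The expected stopping time grows at most like `log (1 / α) / c` for every `c` below the
divergence of the chain from a compact class. -/
lemma limsup_stoppingTime_le {H : Set (Matrix (Fin m) (Fin m) ℝ)}
    (hH : H ⊆ Matrix.rowStochastic ℝ (Fin m)) (hHc : IsCompact H)
    {Q : Matrix (Fin m) (Fin m) ℝ} {p : Fin m → ℝ} (hQ : Q ∈ Matrix.rowStochastic ℝ (Fin m))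
    (hirr : Q.IsIrreducible) (hp : IsStationary p Q) {μ : Fin m → ℝ}
    (hμ : μ ∈ stdSimplex ℝ (Fin m)) {Ω : Type*} [MeasurableSpace Ω] {ℙ : Measure Ω}
    [IsProbabilityMeasure ℙ] {X : ℕ → Ω → Fin m} (hX : IsMarkovChain ℙ X μ Q) {c : ℝ}
    (hc0 : 0 < c) (hc : ENNReal.ofReal c < stationaryKLInf p Q H) :
    limsup (fun α : ℝ => (∫⁻ ω, stoppingTime H α (fun t => X t ω) ∂ℙ) /
      ENNReal.ofReal (Real.log (1 / α))) (𝓝[>] 0) ≤ ENNReal.ofReal (1 / c) := by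
  obtain ⟨c₁, -, hcc₁, hc₁⟩ := ENNReal.lt_iff_exists_real_btwn.1 hc
  have hcc : c < c₁ := (ENNReal.ofReal_lt_ofReal_iff_of_nonneg hc0.le).1 hcc₁
  obtain ⟨δ, hδ, htr⟩ := exists_truncKL_gt hp.mem_simplex.1 hQ hH hHc hc₁
  have hm : 0 < m := by
    rcases Nat.eq_zero_or_pos m with rfl | h
    · simpa using hμ.2
    · exact h
  obtain ⟨t₁, ht₁⟩ := exists_psi_le hm (sub_pos.2 hcc)
  set K := ∑' t : ℕ, ℙ {ω | badPath p Q δ t fun s => X s ω} with hK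
  have hKtop : K ≠ ⊤ := hX.tsum_badPath_ne_top hQ hirr hp hμ hδ
  refine limsup_div_log_le (C := t₁ + 2 + K.toReal) fun α hα0 hα1 => ?_
  have hl : 0 < Real.log (1 / α) := Real.log_pos (by rw [lt_div_iff₀ hα0]; linarith)
  set T : ℕ := t₁ + 1 + ⌈Real.log (1 / α) / c⌉₊ with hT
  have hTle : (T : ℝ) ≤ t₁ + 2 + 1 / c * Real.log (1 / α) := by
    have := (Nat.ceil_lt_add_one (div_pos hl hc0).le).le
    rw [hT]
    push_cast
    rw [one_div_mul_eq_div]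
    linarith
  have hreject : ∀ x : ℕ → Fin m, ∀ t ≥ T, ¬ badPath p Q δ t x →
      ENNReal.ofReal (boundary α x t) ≤ statistic H x t := by
    intro x t ht hx
    refine boundary_le_statistic hH hδ.le htr (by omega) hx ?_
    have h1 := ht₁ t (by omega) x
    have h2 : Real.log (1 / α) / c ≤ t :=
      (Nat.le_ceil _).trans (by exact_mod_cast (by omega : ⌈Real.log (1 / α) / c⌉₊ ≤ t))
    rw [div_le_iff₀ hc0] at h2
    rw [boundary]
    linarith
  refine (lintegral_stoppingTime_le (by omega) hreject).trans ?_
  rw [← hK, ← ENNReal.ofReal_toReal hKtop, ← ENNReal.ofReal_natCast T,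
    ← ENNReal.ofReal_add (Nat.cast_nonneg _) ENNReal.toReal_nonneg,
    ENNReal.toReal_ofReal ENNReal.toReal_nonneg]
  exact ENNReal.ofReal_le_ofReal (by linarith)

end MarkovTest

theorem mainTheorem6 (m : ℕ) (π : Fin m → ℝ) (hπ : π ∈ stdSimplex ℝ (Fin m))
    (hπ_pos : ∀ i, 0 < π i) :
    IsCompact (MarkovTest.nullClass π) ∧
    ∀ (Q : Matrix (Fin m) (Fin m) ℝ) (πQ : Fin m → ℝ),
      MarkovTest.IsErgodic Q → MarkovTest.IsStationary πQ Q → πQ ≠ π →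
      ∀ (μ : Fin m → ℝ), μ ∈ stdSimplex ℝ (Fin m) →
      ∀ (Ω : Type*) [MeasurableSpace Ω] (ℙ : Measure Ω) [IsProbabilityMeasure ℙ]
        (X : ℕ → Ω → Fin m), MarkovTest.IsMarkovChain ℙ X μ Q →
      limsup (fun α : ℝ =>
          (∫⁻ ω, MarkovTest.stoppingTime (MarkovTest.nullClass π) α (fun t => X t ω) ∂ℙ) /
            ENNReal.ofReal (Real.log (1 / α))) (𝓝[>] 0)
        ≤ 1 / MarkovTest.stationaryKLInf πQ Q (MarkovTest.nullClass π) := by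

  refine ⟨MarkovTest.isCompact_nullClass π, ?_⟩
  intro Q πQ hQ hs _ μ hμ Ω _ ℙ _ X hX
  rw [one_div, ENNReal.le_inv_iff_le_inv]
  refine le_of_forall_lt fun y hy => ?_
  obtain ⟨c, hc0, hyc, hc⟩ := ENNReal.lt_iff_exists_real_btwn.1 hy
  have hcpos : 0 < c := ENNReal.ofReal_pos.1 ((zero_le (a := y)).trans_lt hyc)
  refine hyc.trans_le ?_
  rw [ENNReal.le_inv_iff_le_inv, ← ENNReal.ofReal_inv_of_pos hcpos, ← one_div]
  exact MarkovTest.limsup_stoppingTime_le (fun P hP => hP.1) (MarkovTest.isCompact_nullClass π)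
    hQ.stochastic hQ.irreducible hs hμ hX hcpos hc
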